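/- Theorem 4.1. Let $X$ and $Y$ be Banach spaces over $\mathbb{K}\in\{\mathbb{R},\mathbb{C}\}$, and let $k\in\mathbb{Z}$. Write $\mathcal{B}(X,Y)$ for the set of bounded linear operators from $X$ to $Y$, and $\mathcal{B}(X)=\mathcal{B}(X,X)$. Let $\Phi_k(X)$ be the set of Fredholm operators of index $k$ on $X$, that is, of those $U\in\mathcal{B}(X)$ for which $\dim\ker U$ and $\dim X/\operatorname{ran}U$ are finite and $\dim\ker U-\dim X/\operatorname{ran}U=k$. Operators $U\in\mathcal{B}(X)$ and $V\in\mathcal{B}(Y)$ are *equivalent after extension* if there are Banach spaces $X_0$, $Y_0$ and isomorphisms $E\in\mathcal{B}(Y\oplus Y_0,X\oplus X_0)$ and $F\in\mathcal{B}(X\oplus X_0,Y\oplus Y_0)$ such that $$\begin{bmatrix}U&0\\0&I_{X_0}\end{bmatrix}=E\begin{bmatrix}V&0\\0&I_{Y_0}\end{bmatrix}F .$$ They are *Schur coupled* if there are isomorphisms $A\in\mathcal{B}(X)$, $D\in\mathcal{B}(Y)$ and operators $B\in\mathcal{B}(Y,X)$, $C\in\mathcal{B}(X,Y)$ such that $U=A-BD^{-1}C$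 and $V=D-CA^{-1}B$. Let $\operatorname{EAE}_k(X,Y)$ and $\operatorname{SC}_k(X,Y)$ be the sets of pairs $(U,V)\in\Phi_k(X)\times\Phi_k(Y)$ that are equivalent after extension and Schur coupled, respectively. The following four conditions are equivalent: (i) there are operators $S\in\mathcal{B}(Y,X)$ and $T\in\mathcal{B}(X,Y)$ such that $I_X-ST\in\Phi_k(X)$; (ii) there are operators $S\in\mathcal{B}(Y,X)$ and $T\in\mathcal{B}(X,Y)$ such that $I_Y-TS\in\Phi_k(Y)$; (iii) $\operatorname{EAE}_k(X,Y)=\operatorname{SC}_k(X,Y)$, and this set is non-empty; (iv) $\operatorname{SC}_k(X,Y)\neq\emptyset$. -/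

import Mathlib

universe u v

section Fredholm

variable {𝕜 : Type*} [RCLike 𝕜]
variable {X : Type*} [NormedAddCommGroup X] [NormedSpace 𝕜 X]
variable {Y : Type*} [NormedAddCommGroup Y] [NormedSpace 𝕜 Y]

/-- A bounded operator between Banach spaces is Fredholm (in Mathlib's sense) if and only if its
kernel is finite-dimensional and its range has finite codimension; so Mathlib's notion is the
classical one on all the spaces considered below. -/
theorem isFredholm_iff_finiteDimensional [CompleteSpace X] [CompleteSpace Y] (T : X →L[𝕜] Y) :
    T.IsFredholm ↔ FiniteDimensional 𝕜 T.ker ∧ FiniteDimensional 𝕜 (Y ⧸ T.range) := by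
  refine ⟨fun h => ⟨h.finite_ker, h.finite_coker⟩, fun ⟨h1, h2⟩ => ?_⟩
  obtain ⟨X₁, hX₁⟩ :=
    (Submodule.ClosedComplemented.of_finiteDimensional T.ker).exists_isTopCompl
  have hc : IsCompl T.ker X₁ := hX₁.isCompl
  have hcl : IsClosed (X₁ : Set X) := hX₁.symm.isClosed
  have : CompleteSpace X₁ := hcl.completeSpace_coe
  have hrange : (T.comp X₁.subtypeL).range = T.range := by
    apply le_antisymm
    · rintro _ ⟨x, rfl⟩
      exact ⟨x, rfl⟩
    · rintro _ ⟨x, rfl⟩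
      obtain ⟨a, ha, b, hb, rfl⟩ := Submodule.mem_sup.1
        (show x ∈ T.ker ⊔ X₁ from hc.sup_eq_top ▸ Submodule.mem_top)
      refine ⟨⟨b, hb⟩, ?_⟩
      have : T a = 0 := ha
      simp [this]
  have hker : (T.comp X₁.subtypeL).ker = ⊥ := by
    rw [eq_bot_iff]
    rintro ⟨x, hx⟩ hxT
    have hx0 : x ∈ T.ker ⊓ X₁ := ⟨hxT, hx⟩
    rw [hc.inf_eq_bot] at hx0
    exact Subtype.ext hx0
  obtain ⟨G, hG⟩ := Submodule.exists_isCompl T.range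
  have : FiniteDimensional 𝕜 G := (Submodule.quotientEquivOfIsCompl _ _ hG).finiteDimensional
  have hran : IsClosed (T.range : Set Y) := by
    rw [← hrange] at hG ⊢
    exact (T.comp X₁.subtypeL).closed_complemented_range_of_isCompl_of_ker_eq_bot G hG
      G.closed_of_finiteDimensional hker
  have : CompleteSpace T.range := hran.completeSpace_coe
  have hX₁fin : X₁.CoFG :=
    (Submodule.quotientEquivOfIsCompl _ _ hc.symm).symm.finiteDimensional
  have hmaps : Set.MapsTo T X₁ T.range := fun x _ => ⟨x, rfl⟩
  have : T.range.CoFG := h2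
  refine ContinuousLinearMap.IsFredholm.of_isInvertible_restrict hcl hran hmaps ?_
  refine ⟨ContinuousLinearEquiv.ofBijective (T.restrict hmaps) ?_ ?_, ?_⟩
  · rw [eq_bot_iff]
    rintro x hx
    have hx' : x ∈ (T.comp X₁.subtypeL).ker := congrArg Subtype.val hx
    rwa [hker] at hx'
  · rw [eq_top_iff]
    rintro ⟨y, hy⟩ -
    rw [← hrange] at hy
    obtain ⟨x, hx⟩ := hy
    exact ⟨x, Subtype.ext hx⟩
  · ext x
    simp

/-- The index `α(T) - β(T)` of an operator, where `α(T)` is the dimension of the kernel and `β(T)`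
the codimension of the range (only meaningful when both are finite). -/
noncomputable def fredholmIndex (T : X →L[𝕜] Y) : ℤ :=
  (Module.finrank 𝕜 T.ker : ℤ) - (Module.finrank 𝕜 (Y ⧸ T.range) : ℤ)

variable (𝕜 X Y) in
/-- The set `Φ_k(X, Y)` of Fredholm operators from `X` to `Y` of index `k`. -/
def fredholmOfIndex (k : ℤ) : Set (X →L[𝕜] Y) :=
  {T | T.IsFredholm ∧ fredholmIndex T = k}

end Fredholm

section Relations

variable {𝕜 : Type*} [RCLike 𝕜]
variable {X : Type u} [NormedAddCommGroup X] [NormedSpace 𝕜 X]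
variable {Y : Type v} [NormedAddCommGroup Y] [NormedSpace 𝕜 Y]

/-- `U` and `V` are equivalent after extension: there are Banach spaces `X₀`, `Y₀` and isomorphisms
`E : Y ⊕ Y₀ → X ⊕ X₀` and `F : X ⊕ X₀ → Y ⊕ Y₀` with `U ⊕ I = E (V ⊕ I) F`. -/
def EquivalentAfterExtension (U : X →L[𝕜] X) (V : Y →L[𝕜] Y) : Prop :=
  ∃ (X₀ Y₀ : Type (max u v))
    (_ : NormedAddCommGroup X₀) (_ : NormedSpace 𝕜 X₀) (_ : CompleteSpace X₀)
    (_ : NormedAddCommGroup Y₀) (_ : NormedSpace 𝕜 Y₀) (_ : CompleteSpace Y₀)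
    (E : (Y × Y₀) ≃L[𝕜] (X × X₀)) (F : (X × X₀) ≃L[𝕜] (Y × Y₀)),
    U.prodMap (ContinuousLinearMap.id 𝕜 X₀) =
      (E : (Y × Y₀) →L[𝕜] (X × X₀)) ∘L V.prodMap (ContinuousLinearMap.id 𝕜 Y₀) ∘L
        (F : (X × X₀) →L[𝕜] (Y × Y₀))

/-- `U` and `V` are Schur coupled: `U = A - B D⁻¹ C` and `V = D - C A⁻¹ B` for some isomorphisms
`A`, `D` and bounded operators `B`, `C`. -/
def SchurCoupled (U : X →L[𝕜] X) (V : Y →L[𝕜] Y) : Prop :=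
  ∃ (A : X ≃L[𝕜] X) (D : Y ≃L[𝕜] Y) (B : Y →L[𝕜] X) (C : X →L[𝕜] Y),
    U = (A : X →L[𝕜] X) - B ∘L (D.symm : Y →L[𝕜] Y) ∘L C ∧
    V = (D : Y →L[𝕜] Y) - C ∘L (A.symm : X →L[𝕜] X) ∘L B

variable (𝕜 X Y) in
/-- `EAE_k(X, Y)`: the pairs of Fredholm operators of index `k` on `X` and on `Y` which are
equivalent after extension. -/
def eaePairs (k : ℤ) : Set ((X →L[𝕜] X) × (Y →L[𝕜] Y)) :=
  {p | p.1 ∈ fredholmOfIndex 𝕜 X X k ∧ p.2 ∈ fredholmOfIndex 𝕜 Y Y k ∧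
    EquivalentAfterExtension p.1 p.2}

variable (𝕜 X Y) in
/-- `SC_k(X, Y)`: the pairs of Fredholm operators of index `k` on `X` and on `Y` which are
Schur coupled. -/
def scPairs (k : ℤ) : Set ((X →L[𝕜] X) × (Y →L[𝕜] Y)) :=
  {p | p.1 ∈ fredholmOfIndex 𝕜 X X k ∧ p.2 ∈ fredholmOfIndex 𝕜 Y Y k ∧ SchurCoupled p.1 p.2}

end Relations

/-! A Fredholm operator is governed by its pair (n, m) of kernel dimension and range codimension.
Equivalence after extension preserves this pair, and two operators between the same Banach spaces
with the same pair differ only by automorphisms on either side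
(`HasDefectNumbers.exists_eq_equiv_comp`). Schur coupling implies equivalence after extension and
survives such automorphisms. To couple U and V, both with pair (n, m), it therefore suffices to find
S, T for which I - ST has exactly that pair: I - TS is Schur coupled to I - ST, hence has the same
pair.

Condition (i) prescribes only n - m. Rank-one changes of S move n and m together by one, down
(`HasDefectNumbers.exists_lower`) or, if n ≠ m, up (`HasDefectNumbers.exists_raise`). Raising can
break down for n = m (take T = 0), so index zero gets a direct construction from the kernels of U
and V. Conversely, a Schur coupled pair yields (i), since A⁻¹U has the form I - ST. -/

section DefectNumbers

variable {𝕜 : Type*} [RCLike 𝕜]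
variable {X : Type*} [NormedAddCommGroup X] [NormedSpace 𝕜 X]
variable {Y : Type*} [NormedAddCommGroup Y] [NormedSpace 𝕜 Y]
variable {Z : Type*} [NormedAddCommGroup Z] [NormedSpace 𝕜 Z]
variable {W : Type*} [NormedAddCommGroup W] [NormedSpace 𝕜 W]

/-! ### Defect numbers and their invariance -/

/-- The kernel of `T` has finite dimension `n` and its range has finite codimension `m`. -/
structure HasDefectNumbers (T : X →L[𝕜] Y) (n m : ℕ) : Prop where
  finite_ker : FiniteDimensional 𝕜 T.ker
  finite_coker : FiniteDimensional 𝕜 (Y ⧸ T.range)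
  finrank_ker : Module.finrank 𝕜 T.ker = n
  finrank_coker : Module.finrank 𝕜 (Y ⧸ T.range) = m

theorem mem_fredholmOfIndex_iff [CompleteSpace X] [CompleteSpace Y] (T : X →L[𝕜] Y) (k : ℤ) :
    T ∈ fredholmOfIndex 𝕜 X Y k ↔ ∃ n m : ℕ, HasDefectNumbers T n m ∧ (n : ℤ) - m = k := by
  constructor
  · rintro ⟨h, rfl⟩
    obtain ⟨h1, h2⟩ := (isFredholm_iff_finiteDimensional T).1 h
    exact ⟨_, _, ⟨h1, h2, rfl, rfl⟩, rfl⟩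
  · rintro ⟨n, m, ⟨h1, h2, rfl, rfl⟩, rfl⟩
    exact ⟨(isFredholm_iff_finiteDimensional T).2 ⟨h1, h2⟩, rfl⟩

theorem HasDefectNumbers.congr {T : X →L[𝕜] Y} {T' : Z →L[𝕜] W} {n m : ℕ}
    (h : HasDefectNumbers T n m) (e : T.ker ≃ₗ[𝕜] T'.ker)
    (e' : (Y ⧸ T.range) ≃ₗ[𝕜] (W ⧸ T'.range)) : HasDefectNumbers T' n m := by
  have := h.finite_ker
  have := h.finite_coker
  exact ⟨e.finiteDimensional, e'.finiteDimensional, e.finrank_eq ▸ h.finrank_ker,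
    e'.finrank_eq ▸ h.finrank_coker⟩

theorem HasDefectNumbers.equiv_comp {T : X →L[𝕜] Y} {n m : ℕ} (h : HasDefectNumbers T n m)
    (E : Y ≃L[𝕜] W) (F : Z ≃L[𝕜] X) :
    HasDefectNumbers ((E : Y →L[𝕜] W) ∘L T ∘L (F : Z →L[𝕜] X)) n m := by
  refine h.congr (F.symm.toLinearEquiv.submoduleMap T.ker ≪≫ₗ LinearEquiv.ofEq _ _ ?_)
    (Submodule.Quotient.equiv _ _ E.toLinearEquiv ?_)
  · ext x
    constructor
    · rintro ⟨y, hy, rfl⟩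
      have hy' : T y = 0 := hy
      simp [hy']
    · intro hx
      have hx' : E (T (F x)) = 0 := hx
      exact ⟨F x, by simpa using hx', by simp⟩
  · ext y
    constructor
    · rintro ⟨_, ⟨x, rfl⟩, rfl⟩
      exact ⟨F.symm x, by simp⟩
    · rintro ⟨x, rfl⟩
      exact ⟨T (F x), ⟨F x, rfl⟩, rfl⟩

theorem hasDefectNumbers_prodMap_id_iff (T : X →L[𝕜] Y) (n m : ℕ) :
    HasDefectNumbers (T.prodMap (ContinuousLinearMap.id 𝕜 Z)) n m ↔ HasDefectNumbers T n m := by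
  let e : T.ker ≃ₗ[𝕜] (T.prodMap (ContinuousLinearMap.id 𝕜 Z)).ker :=
    Submodule.equivMapOfInjective (LinearMap.inl 𝕜 X Z) LinearMap.inl_injective T.ker ≪≫ₗ
      LinearEquiv.ofEq _ _ (by
        ext ⟨x, z⟩
        constructor
        · rintro ⟨y, hy, h⟩
          have hy' : T y = 0 := hy
          obtain ⟨rfl, rfl⟩ := Prod.ext_iff.1 h
          simp [hy']
        · intro h
          have h' : (T x, z) = 0 := h
          obtain ⟨h1, h2⟩ := Prod.ext_iff.1 h'
          exact ⟨x, h1, Prod.ext rfl h2.symm⟩)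
  let q : (Y × Z) →ₗ[𝕜] (Y ⧸ T.range) := T.range.mkQ ∘ₗ LinearMap.fst 𝕜 Y Z
  have hq : LinearMap.ker q = (T.prodMap (ContinuousLinearMap.id 𝕜 Z)).range := by
    ext ⟨y, z⟩
    constructor
    · intro h
      obtain ⟨x, hx⟩ := (Submodule.Quotient.mk_eq_zero T.range).1 h
      exact ⟨(x, z), Prod.ext hx rfl⟩
    · rintro ⟨⟨x, z'⟩, h⟩
      exact (Submodule.Quotient.mk_eq_zero T.range).2 ⟨x, (Prod.ext_iff.1 h).1⟩
  let e' : (Y ⧸ T.range) ≃ₗ[𝕜] ((Y × Z) ⧸ (T.prodMap (ContinuousLinearMap.id 𝕜 Z)).range) :=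
    (q.quotKerEquivOfSurjective
      (T.range.mkQ_surjective.comp Prod.fst_surjective)).symm ≪≫ₗ
      Submodule.quotEquivOfEq _ _ hq
  exact ⟨fun h => h.congr e.symm e'.symm, fun h => h.congr e e'⟩

/-! ### Rank-one perturbations and the defect numbers of I - ST -/

/-- A vector outside a finite-dimensional subspace is separated from it by a functional. -/
theorem exists_dual_eq_one_of_notMem (M : Submodule 𝕜 X) [FiniteDimensional 𝕜 M] {v : X}
    (hv : v ∉ M) : ∃ f : X →L[𝕜] 𝕜, (∀ x ∈ M, f x = 0) ∧ f v = 1 := by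
  obtain ⟨l, hl, hM⟩ := Submodule.exists_le_ker_of_notMem hv
  let P : Submodule 𝕜 X := M ⊔ 𝕜 ∙ v
  obtain ⟨p, hp⟩ := Submodule.ClosedComplemented.of_finiteDimensional P
  refine ⟨(l v)⁻¹ • (LinearMap.toContinuousLinearMap (l ∘ₗ P.subtype)) ∘L p, fun x hx => ?_, ?_⟩
  · have : p x = ⟨x, Submodule.mem_sup_left hx⟩ :=
      hp ⟨x, Submodule.mem_sup_left hx⟩
    have h0 : l x = 0 := hM hx
    simp [this, h0]
  · have hvP : v ∈ P := Submodule.mem_sup_right (Submodule.mem_span_singleton_self v)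
    have : p v = ⟨v, hvP⟩ := hp ⟨v, hvP⟩
    simp [this, hl]

theorem finiteDimensional_quotient_sup_span_singleton_iff (R : Submodule 𝕜 X) (w : X) :
    FiniteDimensional 𝕜 (X ⧸ R ⊔ 𝕜 ∙ w) ↔ FiniteDimensional 𝕜 (X ⧸ R) := by
  let e := Submodule.quotientQuotientEquivQuotientSup R (𝕜 ∙ w)
  have hfin : FiniteDimensional 𝕜 ((𝕜 ∙ w).map R.mkQ) := inferInstance
  constructor
  · intro h
    have := e.symm.finiteDimensional
    exact Module.Finite.of_submodule_quotient ((𝕜 ∙ w).map R.mkQ)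
  · intro h
    exact e.finiteDimensional

theorem finrank_quotient_eq_finrank_quotient_sup_span_singleton_add_one (R : Submodule 𝕜 X)
    [FiniteDimensional 𝕜 (X ⧸ R)] {w : X} (hw : w ∉ R) :
    Module.finrank 𝕜 (X ⧸ R) = Module.finrank 𝕜 (X ⧸ R ⊔ 𝕜 ∙ w) + 1 := by
  let e := Submodule.quotientQuotientEquivQuotientSup R (𝕜 ∙ w)
  have h0 : R.mkQ w ≠ 0 := fun h => hw ((Submodule.Quotient.mk_eq_zero R).1 h)
  rw [← e.finrank_eq, ← Submodule.finrank_quotient_add_finrank ((𝕜 ∙ w).map R.mkQ)]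
  congr 1
  rw [Submodule.map_span, Set.image_singleton, finrank_span_singleton h0]

theorem finrank_sup_span_singleton_eq_add_one (M : Submodule 𝕜 X) [FiniteDimensional 𝕜 M] {v : X}
    (hv : v ∉ M) : Module.finrank 𝕜 (M ⊔ 𝕜 ∙ v : Submodule 𝕜 X) = Module.finrank 𝕜 M + 1 := by
  have h0 : v ≠ 0 := fun h => hv (h ▸ M.zero_mem)
  have h1 : M ⊓ 𝕜 ∙ v = ⊥ := (Submodule.disjoint_span_singleton' h0).2 hv |>.eq_bot
  have h2 := Submodule.finrank_sup_add_finrank_inf_eq M (𝕜 ∙ v)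
  rwa [h1, finrank_bot, finrank_span_singleton h0, add_zero] at h2

/-- Adding to `T` a rank one operator which maps a kernel vector out of the range of `T` lowers
both defect numbers by one. -/
theorem hasDefectNumbers_add_smulRight_iff {T : X →L[𝕜] Y} {f : X →L[𝕜] 𝕜} {x : X} {w : Y}
    (hx : T x = 0) (hf : f x = 1) (hw : w ∉ T.range) (n m : ℕ) :
    HasDefectNumbers (T + f.smulRight w) n m ↔ HasDefectNumbers T (n + 1) (m + 1) := by
  set T' := T + f.smulRight w with hT'
  have hval : ∀ z, T' z = T z + f z • w := fun z => by simp [hT']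
  have hmem : ∀ z, T' z = 0 → T z = 0 ∧ f z = 0 := by
    intro z hz
    have hfz : f z = 0 := by
      by_contra h
      refine hw ⟨-((f z)⁻¹ • z), ?_⟩
      have h1 : T z = -(f z • w) := eq_neg_of_add_eq_zero_left ((hval z).symm.trans hz)
      simp [h1, smul_smul, h]
    refine ⟨?_, hfz⟩
    simpa [hval, hfz] using hz
  have hker : T.ker = T'.ker ⊔ 𝕜 ∙ x := by
    apply le_antisymm
    · intro z hz
      have hz' : T z = 0 := hz
      have h1 : z - f z • x ∈ T'.ker := by
        change T' _ = 0
        simp [hval, hz', hx, hf]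
      have h2 := Submodule.add_mem_sup h1
        (Submodule.smul_mem _ (f z) (Submodule.mem_span_singleton_self (R := 𝕜) x))
      simpa using h2
    · refine sup_le (fun z hz => (hmem z hz).1) ?_
      rw [Submodule.span_singleton_le_iff_mem]
      exact hx
  have hxker : x ∉ T'.ker := fun h => by
    have := (hmem x h).2
    rw [hf] at this
    exact one_ne_zero this
  have hran : T'.range = T.range ⊔ 𝕜 ∙ w := by
    apply le_antisymm
    · rintro _ ⟨z, rfl⟩
      change T' z ∈ _
      rw [hval]
      exact Submodule.add_mem_sup ⟨z, rfl⟩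
        (Submodule.smul_mem _ _ (Submodule.mem_span_singleton_self w))
    · have hwr : w ∈ T'.range := ⟨x, by change T' x = w; simp [hval, hx, hf]⟩
      refine sup_le ?_ ((Submodule.span_singleton_le_iff_mem _ _).2 hwr)
      rintro _ ⟨z, rfl⟩
      have := T'.range.sub_mem ⟨z, rfl⟩ (T'.range.smul_mem (f z) hwr)
      have h2 : T' z - f z • w = T z := by simp [hval]
      exact h2 ▸ this
  constructor
  · rintro ⟨h1, h2, rfl, rfl⟩
    have h3 : FiniteDimensional 𝕜 (Y ⧸ T.range) := by
      rw [hran] at h2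
      exact (finiteDimensional_quotient_sup_span_singleton_iff _ w).1 h2
    refine ⟨hker ▸ inferInstance, h3, ?_, ?_⟩
    · rw [hker, finrank_sup_span_singleton_eq_add_one _ hxker]
    · rw [hran, finrank_quotient_eq_finrank_quotient_sup_span_singleton_add_one _ hw]
  · rintro ⟨h1, h2, h3, h4⟩
    have h5 : FiniteDimensional 𝕜 T'.ker :=
      Submodule.finiteDimensional_of_le (hker ▸ le_sup_left : T'.ker ≤ T.ker)
    refine ⟨h5, ?_, ?_, ?_⟩
    · rw [hran]
      exact (finiteDimensional_quotient_sup_span_singleton_iff _ w).2 h2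
    · rw [hker, finrank_sup_span_singleton_eq_add_one _ hxker] at h3
      omega
    · rw [finrank_quotient_eq_finrank_quotient_sup_span_singleton_add_one _ hw, ← hran] at h4
      omega

/-- A nonzero kernel vector x satisfies x = S(Tx), so Tx ≠ 0 and some functional g on Y has g(Tx) =
1. The rank-one term built from g ∘ T factors through T, so it can be absorbed into S. -/
theorem HasDefectNumbers.exists_lower {S : Y →L[𝕜] X} {T : X →L[𝕜] Y} {n m : ℕ}
    (h : HasDefectNumbers (ContinuousLinearMap.id 𝕜 X - S ∘L T) (n + 1) (m + 1)) :
    ∃ S' : Y →L[𝕜] X, HasDefectNumbers (ContinuousLinearMap.id 𝕜 X - S' ∘L T) n m := by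
  set A := ContinuousLinearMap.id 𝕜 X - S ∘L T with hA
  have hval : ∀ z, A z = z - S (T z) := fun z => by simp [hA]
  obtain ⟨h1, h2, h3, h4⟩ := id h
  obtain ⟨x, hx, hx0⟩ : ∃ x ∈ A.ker, x ≠ 0 := by
    refine (Submodule.ne_bot_iff _).1 fun h0 => ?_
    rw [h0, finrank_bot] at h3
    omega
  obtain ⟨w, hw⟩ : ∃ w, w ∉ A.range := by
    by_contra! hall
    have h0 : A.range = ⊤ := eq_top_iff.2 fun w _ => hall w
    have := Submodule.Quotient.subsingleton_iff.2 h0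
    rw [Module.finrank_zero_of_subsingleton] at h4
    omega
  have hTx : T x ∉ (⊥ : Submodule 𝕜 Y) := fun h0 => hx0 <| by
    have hx' : A x = 0 := hx
    rw [hval, (Submodule.mem_bot 𝕜).1 h0] at hx'
    simpa using hx'
  obtain ⟨g, -, hg⟩ := exists_dual_eq_one_of_notMem _ hTx
  refine ⟨S - g.smulRight w, ?_⟩
  convert (hasDefectNumbers_add_smulRight_iff (f := g ∘L T) hx hg hw n m).2 h using 1
  ext z
  simp [hA]
  abel

/-- This reverses the lowering step: x is made a new kernel vector by subtracting g(Tz) Ax from Az,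
where g vanishes on T(ker A) and g(Tx) = 1. Such a g requires x outside ker A + ker T. If there were
no such x, then, A being the identity on ker T, X would be the direct sum of ker A and ker T with
ran A = ker T, forcing n = m. -/
theorem HasDefectNumbers.exists_raise {S : Y →L[𝕜] X} {T : X →L[𝕜] Y} {n m : ℕ}
    (h : HasDefectNumbers (ContinuousLinearMap.id 𝕜 X - S ∘L T) n m) (hnm : n ≠ m) :
    ∃ S' : Y →L[𝕜] X, HasDefectNumbers (ContinuousLinearMap.id 𝕜 X - S' ∘L T) (n + 1) (m + 1) := by
  set A := ContinuousLinearMap.id 𝕜 X - S ∘L T with hA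
  have hval : ∀ z, A z = z - S (T z) := fun z => by simp [hA]
  obtain ⟨h1, h2, h3, h4⟩ := id h
  obtain ⟨x, hx⟩ : ∃ x, x ∉ A.ker ⊔ T.ker := by
    by_contra! hall
    have hid : ∀ z, T z = 0 → A z = z := fun z hz => by simp [hval, hz]
    have hcompl : IsCompl T.ker A.ker := by
      refine ⟨Submodule.disjoint_def.2 fun z hz hz' => ?_, ?_⟩
      · exact (hid z hz).symm.trans hz'
      · rw [codisjoint_iff, sup_comm]
        exact eq_top_iff.2 fun z _ => hall z
    have hran : A.range = T.ker := by
      apply le_antisymm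
      · rintro _ ⟨z, rfl⟩
        obtain ⟨a, ha, b, hb, rfl⟩ := Submodule.mem_sup.1 (hall z)
        have ha' : A a = 0 := ha
        change A (a + b) ∈ _
        rw [map_add, ha', hid b hb, zero_add]
        exact hb
      · exact fun z hz => ⟨z, hid z hz⟩
    apply hnm
    rw [← h3, ← h4, hran, (Submodule.quotientEquivOfIsCompl _ _ hcompl).finrank_eq]
  have hTx : T x ∉ A.ker.map T.toLinearMap := by
    rintro ⟨a, ha, hax⟩
    refine hx (Submodule.mem_sup.2 ⟨a, ha, x - a, ?_, by abel⟩)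
    change T (x - a) = 0
    rw [map_sub, sub_eq_zero]
    exact hax.symm
  obtain ⟨g, hg, hgx⟩ := exists_dual_eq_one_of_notMem _ hTx
  have hgker : ∀ z, A z = 0 → g (T z) = 0 := fun z hz => hg _ ⟨z, hz, rfl⟩
  refine ⟨S + g.smulRight (A x), ?_⟩
  set B := ContinuousLinearMap.id 𝕜 X - (S + g.smulRight (A x)) ∘L T with hB
  have hBval : ∀ z, B z = A z - g (T z) • A x := fun z => by simp [hA, hB]; abel
  have hAB : A = B + (g ∘L T).smulRight (A x) := by
    ext z
    simp [hBval]
  rw [hAB] at h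
  refine (hasDefectNumbers_add_smulRight_iff (f := g ∘L T) ?_ hgx ?_ n m).1 h
  · simp [hBval, hgx]
  · rintro ⟨z, hz⟩
    have hz' : A z - g (T z) • A x = A x := (hBval z).symm.trans hz
    -- If Bz = Ax, then z - g(Tz)x - x lies in ker A, yet g ∘ T takes the value -1 there.
    have h0 := hgker (z - g (T z) • x - x) (by simp [hz'])
    simp [hgx] at h0

/-- The kernels of U and V have equal dimension, so a projection p onto ker U factors through ker V,
hence through Y. Then I - p has kernel ker U and range ker p. -/
theorem exists_hasDefectNumbers_id_sub_comp_self {U : X →L[𝕜] X} {V : Y →L[𝕜] Y} {n : ℕ}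
    (hU : HasDefectNumbers U n n) (hV : HasDefectNumbers V n n) :
    ∃ (S : Y →L[𝕜] X) (T : X →L[𝕜] Y),
      HasDefectNumbers (ContinuousLinearMap.id 𝕜 X - S ∘L T) n n := by
  have := hU.finite_ker
  have := hV.finite_ker
  obtain ⟨p, hp⟩ := Submodule.ClosedComplemented.of_finiteDimensional U.ker
  obtain ⟨q, hq⟩ := Submodule.ClosedComplemented.of_finiteDimensional V.ker
  obtain ⟨e⟩ := FiniteDimensional.nonempty_continuousLinearEquiv_of_finrank_eq
    (hU.finrank_ker.trans hV.finrank_ker.symm)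
  refine ⟨U.ker.subtypeL ∘L (e.symm : V.ker →L[𝕜] U.ker) ∘L q,
    V.ker.subtypeL ∘L (e : U.ker →L[𝕜] V.ker) ∘L p, ?_⟩
  set A := ContinuousLinearMap.id 𝕜 X - (U.ker.subtypeL ∘L (e.symm : V.ker →L[𝕜] U.ker) ∘L q) ∘L
    (V.ker.subtypeL ∘L (e : U.ker →L[𝕜] V.ker) ∘L p) with hA
  have hval : ∀ z, A z = z - p z := fun z => by simp [hA, hq]
  have hker : A.ker = U.ker := by
    ext z
    constructor
    · intro hz
      have hz' : z - p z = 0 := (hval z).symm.trans hz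
      rw [sub_eq_zero.1 hz']
      exact (p z).2
    · intro hz
      have := hp ⟨z, hz⟩
      change A z = 0
      rw [hval, this, sub_self]
  have hran : A.range = p.ker := by
    ext z
    constructor
    · rintro ⟨z, rfl⟩
      change p (A z) = 0
      rw [hval, map_sub, hp, sub_self]
    · intro hz
      have hz' : p z = 0 := hz
      exact ⟨z, by change A z = z; simp [hval, hz']⟩
  have e' : (X ⧸ A.range) ≃ₗ[𝕜] U.ker :=
    Submodule.quotEquivOfEq _ _ hran ≪≫ₗ
      p.toLinearMap.quotKerEquivOfSurjective fun z => ⟨z, hp z⟩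
  exact ⟨hker ▸ inferInstance, e'.symm.finiteDimensional, hker ▸ hU.finrank_ker,
    e'.finrank_eq.trans hU.finrank_ker⟩

theorem exists_hasDefectNumbers_id_sub_comp {U : X →L[𝕜] X} {V : Y →L[𝕜] Y}
    {S : Y →L[𝕜] X} {T : X →L[𝕜] Y} {n m n' m' : ℕ}
    (hU : HasDefectNumbers U n m) (hV : HasDefectNumbers V n m)
    (h : HasDefectNumbers (ContinuousLinearMap.id 𝕜 X - S ∘L T) n' m')
    (hindex : (n' : ℤ) - m' = n - m) :
    ∃ (S : Y →L[𝕜] X) (T : X →L[𝕜] Y),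
      HasDefectNumbers (ContinuousLinearMap.id 𝕜 X - S ∘L T) n m := by
  by_cases hnm : n = m
  · subst hnm
    exact exists_hasDefectNumbers_id_sub_comp_self hU hV
  have hraise : ∀ j : ℕ, ∃ S : Y →L[𝕜] X,
      HasDefectNumbers (ContinuousLinearMap.id 𝕜 X - S ∘L T) (n' + j) (m' + j) := by
    intro j
    induction j with
    | zero => exact ⟨S, h⟩
    | succ j ih =>
      obtain ⟨S, hS⟩ := ih
      exact hS.exists_raise (by omega)
  have hlower : ∀ j a b : ℕ, (∃ S : Y →L[𝕜] X,
      HasDefectNumbers (ContinuousLinearMap.id 𝕜 X - S ∘L T) (a + j) (b + j)) →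
      ∃ S : Y →L[𝕜] X, HasDefectNumbers (ContinuousLinearMap.id 𝕜 X - S ∘L T) a b := by
    intro j
    induction j with
    | zero => exact fun a b h => h
    | succ j ih =>
      rintro a b ⟨S, hS⟩
      exact ih a b (HasDefectNumbers.exists_lower hS)
  -- Raise n times, then lower n' times; equality of the indices gives m' + n = m + n'.
  obtain ⟨S', hS'⟩ := hlower n' n m (by
    obtain ⟨S, hS⟩ := hraise n
    refine ⟨S, ?_⟩
    rwa [show n + n' = n' + n by omega, show m + n' = m' + n by omega])
  exact ⟨S', T, hS'⟩

/-! ### Equivalence of operators with equal defect numbers -/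

theorem exists_linearEquiv_map_eq {V : Type*} [AddCommGroup V] [Module 𝕜 V]
    [FiniteDimensional 𝕜 V] {M N : Submodule 𝕜 V}
    (h : Module.finrank 𝕜 M = Module.finrank 𝕜 N) :
    ∃ e : V ≃ₗ[𝕜] V, M.map e.toLinearMap = N := by
  obtain ⟨M', hM⟩ := M.exists_isCompl
  obtain ⟨N', hN⟩ := N.exists_isCompl
  have h1 := Submodule.finrank_add_eq_of_isCompl hM
  have h2 := Submodule.finrank_add_eq_of_isCompl hN
  let e₁ := LinearEquiv.ofFinrankEq M N h
  let e₂ := LinearEquiv.ofFinrankEq (R := 𝕜) M' N' (by omega)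
  let e := (Submodule.prodEquivOfIsCompl M M' hM).symm ≪≫ₗ e₁.prodCongr e₂ ≪≫ₗ
    Submodule.prodEquivOfIsCompl N N' hN
  refine ⟨e, Submodule.eq_of_le_of_finrank_eq ?_ ?_⟩
  · rintro _ ⟨x, hx, rfl⟩
    have h3 : (Submodule.prodEquivOfIsCompl M M' hM).symm x = (⟨x, hx⟩, 0) :=
      Submodule.prodEquivOfIsCompl_symm_apply_left M M' hM ⟨x, hx⟩
    simp [e, h3]
  · rw [← h]
    exact e.finrank_map_eq M

/-- Finite-dimensional subspaces of equal dimension are exchanged by an automorphism of the whole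
space. -/
theorem exists_continuousLinearEquiv_map_eq {M N : Submodule 𝕜 X}
    [FiniteDimensional 𝕜 M] [FiniteDimensional 𝕜 N]
    (h : Module.finrank 𝕜 M = Module.finrank 𝕜 N) :
    ∃ e : X ≃L[𝕜] X, M.map e.toLinearEquiv.toLinearMap = N := by
  -- The exchange takes place inside the finite-dimensional space M + N and is extended by the
  -- identity on a closed complement.
  let P : Submodule 𝕜 X := M ⊔ N
  obtain ⟨Q, hQ⟩ := (Submodule.ClosedComplemented.of_finiteDimensional P).exists_isTopCompl
  have hMP : M ≤ P := le_sup_left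
  have hNP : N ≤ P := le_sup_right
  obtain ⟨e₀, he₀⟩ := exists_linearEquiv_map_eq (𝕜 := 𝕜) (V := P)
    (M := M.comap P.subtype) (N := N.comap P.subtype) (by
      rw [(Submodule.comapSubtypeEquivOfLe hMP).finrank_eq,
        (Submodule.comapSubtypeEquivOfLe hNP).finrank_eq, h])
  let e : X ≃L[𝕜] X := (Submodule.prodEquivOfIsTopCompl P Q hQ).symm.trans
    ((e₀.toContinuousLinearEquiv.prodCongr (ContinuousLinearEquiv.refl 𝕜 Q)).trans
      (Submodule.prodEquivOfIsTopCompl P Q hQ))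
  have he : ∀ x : P, e x = e₀ x := by
    intro x
    have : (Submodule.prodEquivOfIsTopCompl P Q hQ).symm (x : X) = (x, 0) := by
      rw [ContinuousLinearEquiv.symm_apply_eq]
      simp
    simp [e, this]
  refine ⟨e, Submodule.eq_of_le_of_finrank_eq ?_ ?_⟩
  · rintro _ ⟨x, hx, rfl⟩
    have h3 : e₀ ⟨x, hMP hx⟩ ∈ N.comap P.subtype := he₀ ▸ ⟨⟨x, hMP hx⟩, hx, rfl⟩
    exact (he ⟨x, hMP hx⟩).symm ▸ h3
  · rw [← h]
    exact e.toLinearEquiv.finrank_map_eq M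

/-- An automorphism carrying M to N induces an isomorphism X/M ≅ X/N, and the complements represent
these quotients. -/
theorem nonempty_continuousLinearEquiv_of_isTopCompl {M N M' N' : Submodule 𝕜 X}
    [FiniteDimensional 𝕜 M] [FiniteDimensional 𝕜 N]
    (h : Module.finrank 𝕜 M = Module.finrank 𝕜 N)
    (hM : Submodule.IsTopCompl M M') (hN : Submodule.IsTopCompl N N') :
    Nonempty (M' ≃L[𝕜] N') := by
  obtain ⟨e, he⟩ := exists_continuousLinearEquiv_map_eq h
  have h1 : ∀ x ∈ M, e x ∈ N := fun x hx => he ▸ ⟨x, hx, rfl⟩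
  have h2 : ∀ y ∈ N, e.symm y ∈ M := by
    intro y hy
    rw [← he] at hy
    obtain ⟨x, hx, rfl⟩ := hy
    simpa using hx
  let p := M'.projectionOntoL M hM.symm
  let q := N'.projectionOntoL N hN.symm
  have hp : ∀ x, p x = 0 ↔ x ∈ M := fun x => Submodule.projectionOntoL_apply_eq_zero_iff _
  have hq : ∀ x, q x = 0 ↔ x ∈ N := fun x => Submodule.projectionOntoL_apply_eq_zero_iff _
  have hpp : ∀ x : M', p x = x := Submodule.projectionOntoL_apply_left _
  have hqq : ∀ x : N', q x = x := Submodule.projectionOntoL_apply_left _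
  refine ⟨ContinuousLinearEquiv.equivOfInverse (q ∘L (e : X →L[𝕜] X) ∘L M'.subtypeL)
    (p ∘L (e.symm : X →L[𝕜] X) ∘L N'.subtypeL) (fun x => ?_) (fun y => ?_)⟩
  · have h3 : (q (e x) : X) - e x ∈ N := by
      rw [← hq, map_sub, hqq, sub_self]
    have h4 := (hp _).2 (h2 _ h3)
    rw [map_sub, map_sub, e.symm_apply_apply, hpp, sub_eq_zero] at h4
    exact h4
  · have h3 : (p (e.symm y) : X) - e.symm y ∈ M := by
      rw [← hp, map_sub, hpp, sub_self]
    have h4 := (hq _).2 (h1 _ h3)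
    rw [map_sub, map_sub, e.apply_symm_apply, hqq, sub_eq_zero] at h4
    exact h4

/-- Operators with the same finite defect numbers are equivalent. -/
theorem HasDefectNumbers.exists_eq_equiv_comp [CompleteSpace X] [CompleteSpace Y]
    {U U' : X →L[𝕜] Y} {n m : ℕ}
    (hU : HasDefectNumbers U n m) (hU' : HasDefectNumbers U' n m) :
    ∃ (G : Y ≃L[𝕜] Y) (H : X ≃L[𝕜] X),
      U' = (G : Y →L[𝕜] Y) ∘L U ∘L (H : X →L[𝕜] X) := by
  obtain ⟨P⟩ := ((isFredholm_iff_finiteDimensional U).2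
    ⟨hU.finite_ker, hU.finite_coker⟩).nonempty_fredholmPackage
  obtain ⟨P'⟩ := ((isFredholm_iff_finiteDimensional U').2
    ⟨hU'.finite_ker, hU'.finite_coker⟩).nonempty_fredholmPackage
  have := P.decDom.finite_X₀
  have := P'.decDom.finite_X₀
  have := P.decCodom.finite_X₀
  have := P'.decCodom.finite_X₀
  have hdom : Module.finrank 𝕜 P'.decDom.X₀ = Module.finrank 𝕜 P.decDom.X₀ := by
    rw [← P.ker_eq, ← P'.ker_eq, hU.finrank_ker, hU'.finrank_ker]
  have hcod : Module.finrank 𝕜 P.decCodom.X₀ = Module.finrank 𝕜 P'.decCodom.X₀ := by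
    rw [← (Submodule.quotientEquivOfIsCompl _ _ P.decCodom.isTopCompl.isCompl).finrank_eq,
      ← (Submodule.quotientEquivOfIsCompl _ _ P'.decCodom.isTopCompl.isCompl).finrank_eq,
      ← P.range_eq, ← P'.range_eq, hU.finrank_coker, hU'.finrank_coker]
  obtain ⟨a⟩ := nonempty_continuousLinearEquiv_of_isTopCompl hdom
    P'.decDom.isTopCompl.symm P.decDom.isTopCompl.symm
  obtain ⟨b⟩ := FiniteDimensional.nonempty_continuousLinearEquiv_of_finrank_eq hdom
  obtain ⟨c⟩ := FiniteDimensional.nonempty_continuousLinearEquiv_of_finrank_eq hcod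
  let H : X ≃L[𝕜] X := (Submodule.prodEquivOfIsTopCompl _ _ P'.decDom.isTopCompl).symm.trans
    ((a.prodCongr b).trans (Submodule.prodEquivOfIsTopCompl _ _ P.decDom.isTopCompl))
  -- On the range of U, G is forced by G U H = U'; on the finite-dimensional complement any
  -- isomorphism `c` will do.
  let G : Y ≃L[𝕜] Y := (Submodule.prodEquivOfIsTopCompl _ _ P.decCodom.isTopCompl).symm.trans
    (((P.equiv.symm.trans (a.symm.trans P'.equiv)).prodCongr c).trans
      (Submodule.prodEquivOfIsTopCompl _ _ P'.decCodom.isTopCompl))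
  have hG : ∀ y : P.decCodom.X₁, G y = P'.equiv (a.symm (P.equiv.symm y)) := by
    intro y
    have : (Submodule.prodEquivOfIsTopCompl _ _ P.decCodom.isTopCompl).symm (y : Y) = (y, 0) := by
      rw [ContinuousLinearEquiv.symm_apply_eq]
      simp
    simp [G, this]
  have hUval : ∀ (x : P.decDom.X₁) (z : P.decDom.X₀), U (x + z) = P.equiv x := by
    intro x z
    refine (DFunLike.congr_fun P.eq_equiv _).trans ?_
    simp
  have hUval' : ∀ (x : P'.decDom.X₁) (z : P'.decDom.X₀), U' (x + z) = P'.equiv x := by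
    intro x z
    refine (DFunLike.congr_fun P'.eq_equiv _).trans ?_
    simp
  refine ⟨G, H, ContinuousLinearMap.ext fun x => ?_⟩
  obtain ⟨⟨y, z⟩, rfl⟩ := (Submodule.prodEquivOfIsTopCompl _ _ P'.decDom.isTopCompl).surjective x
  have hH : H (y + z) = a y + b z := by
    have : (Submodule.prodEquivOfIsTopCompl _ _ P'.decDom.isTopCompl).symm ((y : X) + z) =
        (y, z) := by
      rw [ContinuousLinearEquiv.symm_apply_eq]
      simp
    simp only [H, ContinuousLinearEquiv.trans_apply, this]
    simp
  simp [hH, hUval, hUval', hG]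

end DefectNumbers

/-! ### Equivalence after extension versus Schur coupling -/

section Relations

variable {𝕜 : Type*} [RCLike 𝕜]
variable {X : Type u} [NormedAddCommGroup X] [NormedSpace 𝕜 X]
variable {Y : Type v} [NormedAddCommGroup Y] [NormedSpace 𝕜 Y]

theorem EquivalentAfterExtension.hasDefectNumbers_iff {U : X →L[𝕜] X} {V : Y →L[𝕜] Y}
    (h : EquivalentAfterExtension U V) (n m : ℕ) :
    HasDefectNumbers U n m ↔ HasDefectNumbers V n m := by
  obtain ⟨X₀, Y₀, _, _, _, _, _, _, E, F, hEF⟩ := h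
  rw [← hasDefectNumbers_prodMap_id_iff (Z := X₀) U, ← hasDefectNumbers_prodMap_id_iff (Z := Y₀) V]
  constructor
  · intro h
    convert h.equiv_comp E.symm F.symm using 1
    rw [hEF]
    ext x <;> simp
  · intro h
    rw [hEF]
    exact h.equiv_comp E F

/-- U and V are the two Schur complements of the block operator [A B; C D]. The extension spaces are
X₀ = Y and Y₀ = X, lifted to a common universe. -/
theorem SchurCoupled.equivalentAfterExtension [CompleteSpace X] [CompleteSpace Y]
    {U : X →L[𝕜] X} {V : Y →L[𝕜] Y} (h : SchurCoupled U V) : EquivalentAfterExtension U V := by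
  obtain ⟨A, D, B, C, rfl, rfl⟩ := h
  let iX : ULift.{v} X ≃L[𝕜] X := ContinuousLinearEquiv.ulift
  let iY : ULift.{u} Y ≃L[𝕜] Y := ContinuousLinearEquiv.ulift
  -- F(x, y) = (w, Ax + Bw) with w = D⁻¹(y - Cx).
  let F : (X × Y) ≃L[𝕜] (Y × X) := ContinuousLinearEquiv.equivOfInverse
    (((D.symm : Y →L[𝕜] Y) ∘L (ContinuousLinearMap.snd 𝕜 X Y -
        C ∘L ContinuousLinearMap.fst 𝕜 X Y)).prod
      ((A : X →L[𝕜] X) ∘L ContinuousLinearMap.fst 𝕜 X Y +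
        B ∘L (D.symm : Y →L[𝕜] Y) ∘L (ContinuousLinearMap.snd 𝕜 X Y -
          C ∘L ContinuousLinearMap.fst 𝕜 X Y)))
    (((A.symm : X →L[𝕜] X) ∘L (ContinuousLinearMap.snd 𝕜 Y X -
        B ∘L ContinuousLinearMap.fst 𝕜 Y X)).prod
      ((D : Y →L[𝕜] Y) ∘L ContinuousLinearMap.fst 𝕜 Y X +
        C ∘L (A.symm : X →L[𝕜] X) ∘L (ContinuousLinearMap.snd 𝕜 Y X -
          B ∘L ContinuousLinearMap.fst 𝕜 Y X)))
    (fun p => by ext <;> simp) (fun p => by ext <;> simp)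
  -- E(v, u) = (u - BD⁻¹y, y) with y = v + CA⁻¹u. For v = Vw and u = Ax + Bw this y is Dw + Cx, the
  -- original one.
  let E : (Y × X) ≃L[𝕜] (X × Y) := ContinuousLinearEquiv.equivOfInverse
    ((ContinuousLinearMap.snd 𝕜 Y X - B ∘L (D.symm : Y →L[𝕜] Y) ∘L
        (ContinuousLinearMap.fst 𝕜 Y X +
          C ∘L (A.symm : X →L[𝕜] X) ∘L ContinuousLinearMap.snd 𝕜 Y X)).prod
      (ContinuousLinearMap.fst 𝕜 Y X +
          C ∘L (A.symm : X →L[𝕜] X) ∘L ContinuousLinearMap.snd 𝕜 Y X))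
    ((ContinuousLinearMap.snd 𝕜 X Y - C ∘L (A.symm : X →L[𝕜] X) ∘L
        (ContinuousLinearMap.fst 𝕜 X Y +
          B ∘L (D.symm : Y →L[𝕜] Y) ∘L ContinuousLinearMap.snd 𝕜 X Y)).prod
      (ContinuousLinearMap.fst 𝕜 X Y +
          B ∘L (D.symm : Y →L[𝕜] Y) ∘L ContinuousLinearMap.snd 𝕜 X Y))
    (fun p => by ext <;> simp) (fun p => by ext <;> simp)
  refine ⟨ULift.{u} Y, ULift.{v} X, inferInstance, inferInstance, inferInstance, inferInstance,
    inferInstance, inferInstance,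
    (((ContinuousLinearEquiv.refl 𝕜 Y).prodCongr iX).trans E).trans
      ((ContinuousLinearEquiv.refl 𝕜 X).prodCongr iY.symm),
    (((ContinuousLinearEquiv.refl 𝕜 X).prodCongr iY).trans F).trans
      ((ContinuousLinearEquiv.refl 𝕜 Y).prodCongr iX.symm), ?_⟩
  refine ContinuousLinearMap.ext fun p => ?_
  obtain ⟨x, y⟩ := p
  obtain ⟨y, rfl⟩ := iY.symm.surjective y
  refine Prod.ext ?_ (iY.injective ?_)
  · simp [E, F]
    abel
  · simp [E, F]

/-- G(A - BD⁻¹C)H = GAH - (GBH')(G'DH')⁻¹(G'CH), and symmetrically for V. -/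
theorem SchurCoupled.equiv_comp {U : X →L[𝕜] X} {V : Y →L[𝕜] Y} (h : SchurCoupled U V)
    (G H : X ≃L[𝕜] X) (G' H' : Y ≃L[𝕜] Y) :
    SchurCoupled ((G : X →L[𝕜] X) ∘L U ∘L (H : X →L[𝕜] X))
      ((G' : Y →L[𝕜] Y) ∘L V ∘L (H' : Y →L[𝕜] Y)) := by
  obtain ⟨A, D, B, C, rfl, rfl⟩ := h
  refine ⟨(H.trans A).trans G, (H'.trans D).trans G',
    (G : X →L[𝕜] X) ∘L B ∘L (H' : Y →L[𝕜] Y), (G' : Y →L[𝕜] Y) ∘L C ∘L (H : X →L[𝕜] X), ?_, ?_⟩ <;>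
  · ext z
    simp

theorem schurCoupled_id_sub_comp (S : Y →L[𝕜] X) (T : X →L[𝕜] Y) :
    SchurCoupled (ContinuousLinearMap.id 𝕜 X - S ∘L T) (ContinuousLinearMap.id 𝕜 Y - T ∘L S) :=
  ⟨.refl 𝕜 X, .refl 𝕜 Y, S, T, by ext; simp, by ext; simp⟩

theorem SchurCoupled.mem_fredholmOfIndex_iff [CompleteSpace X] [CompleteSpace Y]
    {U : X →L[𝕜] X} {V : Y →L[𝕜] Y} (h : SchurCoupled U V) (k : ℤ) :
    U ∈ fredholmOfIndex 𝕜 X X k ↔ V ∈ fredholmOfIndex 𝕜 Y Y k := by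
  simp only [_root_.mem_fredholmOfIndex_iff, h.equivalentAfterExtension.hasDefectNumbers_iff]

theorem exists_id_sub_comp_mem_fredholmOfIndex_of_schurCoupled [CompleteSpace X]
    {U : X →L[𝕜] X} {V : Y →L[𝕜] Y} (h : SchurCoupled U V) {k : ℤ}
    (hU : U ∈ fredholmOfIndex 𝕜 X X k) :
    ∃ (S : Y →L[𝕜] X) (T : X →L[𝕜] Y),
      ContinuousLinearMap.id 𝕜 X - S ∘L T ∈ fredholmOfIndex 𝕜 X X k := by
  obtain ⟨A, D, B, C, rfl, -⟩ := h
  obtain ⟨n, m, hnm, rfl⟩ := (_root_.mem_fredholmOfIndex_iff _ _).1 hU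
  -- A⁻¹U = I - (A⁻¹BD⁻¹)C.
  refine ⟨(A.symm : X →L[𝕜] X) ∘L B ∘L (D.symm : Y →L[𝕜] Y), C,
    (_root_.mem_fredholmOfIndex_iff _ _).2 ⟨n, m, ?_, rfl⟩⟩
  convert hnm.equiv_comp A.symm (.refl 𝕜 X) using 1
  ext x
  simp

theorem EquivalentAfterExtension.schurCoupled_of_mem_fredholmOfIndex
    [CompleteSpace X] [CompleteSpace Y]
    {U : X →L[𝕜] X} {V : Y →L[𝕜] Y} (h : EquivalentAfterExtension U V) {k : ℤ}
    (hU : U ∈ fredholmOfIndex 𝕜 X X k) {S : Y →L[𝕜] X} {T : X →L[𝕜] Y}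
    (hST : ContinuousLinearMap.id 𝕜 X - S ∘L T ∈ fredholmOfIndex 𝕜 X X k) :
    SchurCoupled U V := by
  obtain ⟨n, m, hUnm, rfl⟩ := (_root_.mem_fredholmOfIndex_iff _ _).1 hU
  obtain ⟨n', m', hST', hk⟩ := (_root_.mem_fredholmOfIndex_iff _ _).1 hST
  have hVnm := (h.hasDefectNumbers_iff n m).1 hUnm
  obtain ⟨S, T, hX⟩ := exists_hasDefectNumbers_id_sub_comp hUnm hVnm hST' hk
  have hc := schurCoupled_id_sub_comp S T
  have hY := (hc.equivalentAfterExtension.hasDefectNumbers_iff n m).1 hX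
  -- U and V are now obtained from the coupled pair I - ST, I - TS by automorphisms on both sides.
  obtain ⟨G, H, rfl⟩ := hX.exists_eq_equiv_comp hUnm
  obtain ⟨G', H', rfl⟩ := hY.exists_eq_equiv_comp hVnm
  exact hc.equiv_comp G H G' H'

end Relations

theorem theorem4p1 {𝕜 : Type*} [RCLike 𝕜]
    (X : Type u) [NormedAddCommGroup X] [NormedSpace 𝕜 X] [CompleteSpace X]
    (Y : Type v) [NormedAddCommGroup Y] [NormedSpace 𝕜 Y] [CompleteSpace Y] (k : ℤ) :
    List.TFAE [
      ∃ (S : Y →L[𝕜] X) (T : X →L[𝕜] Y),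
        ContinuousLinearMap.id 𝕜 X - S ∘L T ∈ fredholmOfIndex 𝕜 X X k,
      ∃ (S : Y →L[𝕜] X) (T : X →L[𝕜] Y),
        ContinuousLinearMap.id 𝕜 Y - T ∘L S ∈ fredholmOfIndex 𝕜 Y Y k,
      eaePairs 𝕜 X Y k = scPairs 𝕜 X Y k ∧ (scPairs 𝕜 X Y k).Nonempty,
      (scPairs 𝕜 X Y k).Nonempty] := by
  tfae_have 1 ↔ 2 := exists_congr fun S => exists_congr fun T =>
    (schurCoupled_id_sub_comp S T).mem_fredholmOfIndex_iff k
  tfae_have 1 → 3 := by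
    rintro ⟨S, T, h⟩
    refine ⟨Set.ext fun p => ⟨fun ⟨hU, hV, he⟩ => ?_, fun ⟨hU, hV, hs⟩ => ?_⟩, ?_⟩
    · exact ⟨hU, hV, he.schurCoupled_of_mem_fredholmOfIndex hU h⟩
    · exact ⟨hU, hV, hs.equivalentAfterExtension⟩
    · have hc := schurCoupled_id_sub_comp S T
      exact ⟨(_, _), h, (hc.mem_fredholmOfIndex_iff k).1 h, hc⟩
  tfae_have 3 → 4 := And.right
  tfae_have 4 → 1 := fun ⟨_, hU, _, hs⟩ =>
    exists_id_sub_comp_mem_fredholmOfIndex_of_schurCoupled hs hU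
  tfae_finish
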